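/- **Setting.** Let $X$ be a non-empty locally compact Hausdorff space that is Lindelöf. Let $C(X)$ be the algebra of continuous functions $X\to\mathbb{R}$ with pointwise order. A linear subspace $\mathcal I\subseteq C(X)$ is a *Riesz ideal* if $r\in C(X)$, $s\in\mathcal I$ and $|r|\le|s|$ imply $r\in\mathcal I$. A positive linear functional $\Phi:\mathcal I\to\mathbb R$ is *strictly $\mathcal I$-continuous* if $\inf_k\Phi(f_k)=0$ for every decreasing sequence $(f_k)$ in $\mathcal I$ with pointwise infimum $0$. Let $\mathcal I$ be a Riesz ideal and unital subalgebra of $C(X)$, and $\Phi:\mathcal I\to\mathbb R$ a positive, strictly $\mathcal I$-continuous linear functional. Put $\mathcal I_{\mathbb C}=\{f_r+\mathrm i f_i : f_r,f_i\in\mathcal I\}$, a commutative unital $*$-algebra under pointwise operations and complex conjugation, $\Phi_{\mathbb C}(f_r+\mathrm i f_i)=\Phi(f_r)+\mathrm i\,\Phi(f_i)$ and $\|f\|_\Phi=\Phi_{\mathbb C}(f^*f)^{1/2}$ for $f\in\mathcal I_{\mathbb C}$. Let $\mathcal A$ be a unital subalgebra of $\mathcal I$ and $\mathcal A_{\mathbb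 C}\subseteq\mathcal I_{\mathbb C}$ its complex linear span. Let $\mathcal A_{\mathbb C}^{\mathrm{cl}}$ be the closure of $\mathcal A_{\mathbb C}$ in $\mathcal I_{\mathbb C}$ with respect to $\|\cdot\|_\Phi$ and, for $a\in\mathcal A$, let $\mathcal A_{\mathbb C}^{a\text{-}\mathrm{cl}}$ be its closure in $\mathcal I_{\mathbb C}$ with respect to the seminorm $g\mapsto(\|ag\|_\Phi^2+\|g\|_\Phi^2)^{1/2}$. Let $\mathcal G_\Phi=\{b\in\mathcal A_{\mathbb C}:\|b\|_\Phi=0\}$, let $\mathfrak H_\Phi$ be the Hilbert space completion of $\mathcal A_{\mathbb C}/\mathcal G_\Phi$ with inner product $\langle[b],[c]\rangle=\Phi_{\mathbb C}(b^*c)$, and for $a\in\mathcal A$ let $m_a$ be the densely defined symmetric operator $[b]\mapsto[ab]$ on $\mathfrak H_\Phi$ with domain $\mathcal A_{\mathbb C}/\mathcal G_\Phi$ (the multiplication operator by $a$ in the GNS representation). It is *essentially self-adjoint* if the domain of its closure equals the domain of its adjoint. **Theorem.** Let $S\subseteq\mathcal A$ separate the points of $X$. Then the following are equivalent: 1. $\mathcal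 A_{\mathbb C}^{a\text{-}\mathrm{cl}}=\mathcal I_{\mathbb C}$ for all $a\in S$. 2. For every $a\in S$ the operator $m_a$ is essentially self-adjoint. If one, hence both, of these statements hold, then also $\mathcal A_{\mathbb C}^{\mathrm{cl}}=\mathcal I_{\mathbb C}$. -/

import Mathlib

open scoped ComplexOrder

noncomputable section

/-! ## Riesz ideals of `C(X, ℝ)` and strictly continuous positive functionals -/

section Riesz

variable {X : Type*} [TopologicalSpace X]

/-- A linear subspace `I` of `C(X, ℝ)` is a Riesz ideal if `|r| ≤ |s|` with `s ∈ I` implies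
`r ∈ I`. -/
def IsRieszIdeal (I : Submodule ℝ C(X, ℝ)) : Prop :=
  ∀ r s : C(X, ℝ), s ∈ I → |r| ≤ |s| → r ∈ I

/-- A sequence of functions is decreasing with pointwise infimum `0`. -/
def DecreasesToZero (f : ℕ → C(X, ℝ)) : Prop :=
  Antitone f ∧ ∀ x : X, IsGLB (Set.range fun k => f k x) 0

/-- A positive linear functional `Φ` on `I` is strictly `I`-continuous if `Φ (f k)` has infimum `0`
for every decreasing sequence `f` in `I` with pointwise infimum `0`. -/
def IsStrictlyContinuous {I : Subalgebra ℝ C(X, ℝ)} (Φ : I →ₚ[ℝ] ℝ) : Prop :=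
  ∀ f : ℕ → I, DecreasesToZero (fun k => (f k : C(X, ℝ))) →
    IsGLB (Set.range fun k => Φ (f k)) 0

/-- A set `S` of functions in `I` separates the points of `X`. -/
def IsPointSeparating {I : Subalgebra ℝ C(X, ℝ)} (S : Set I) : Prop :=
  ∀ x y : X, x ≠ y → ∃ s ∈ S, (s : C(X, ℝ)) x ≠ (s : C(X, ℝ)) y

end Riesz

/-! ## Positive Hermitian functionals on unital `*`-algebras and the GNS representation -/

section StarAlgebra

/-- A positive Hermitian linear functional on a complex unital `*`-algebra. -/
structure PosHermMap (R : Type*) [Ring R] [StarRing R] [Algebra ℂ R] [StarModule ℂ R]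
    extends R →ₗ[ℂ] ℂ where
  map_star' : ∀ f : R, toFun (star f) = star (toFun f)
  nonneg' : ∀ f : R, 0 ≤ toFun (star f * f)

namespace PosHermMap

variable {R : Type*} [Ring R] [StarRing R] [Algebra ℂ R] [StarModule ℂ R] (φ : PosHermMap R)

/-- The seminorm `‖f‖_φ = φ (f* f) ^ (1/2)`. -/
def seminorm (f : R) : ℝ := √(φ.toLinearMap (star f * f)).re

/-- The graph seminorm `(‖a g‖_φ ^ 2 + ‖g‖_φ ^ 2) ^ (1/2)` of `g`. -/
def graphSeminorm (a g : R) : ℝ := √(φ.seminorm (a * g) ^ 2 + φ.seminorm g ^ 2)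

/-- The closure of `T` in `R` with respect to the topology of `‖·‖_φ`. -/
def closure (T : Set R) : Set R :=
  {g | ∀ ε : ℝ, 0 < ε → ∃ b ∈ T, φ.seminorm (g - b) < ε}

/-- The `a`-`‖·‖_φ`-closure of `T` in `R`: the closure with respect to the topology of the graph
seminorm of `a`. -/
def graphClosure (a : R) (T : Set R) : Set R :=
  {g | ∀ ε : ℝ, 0 < ε → ∃ b ∈ T, φ.graphSeminorm a (g - b) < ε}

/-- The restriction of a positive Hermitian functional to a unital `*`-subalgebra. -/
def restrict (𝒜 : StarSubalgebra ℂ R) : PosHermMap 𝒜 where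
  toLinearMap := φ.toLinearMap ∘ₗ 𝒜.subtype.toAlgHom.toLinearMap
  map_star' f := φ.map_star' (f : R)
  nonneg' f := φ.nonneg' (f : R)

/-- The positive sesquilinear form `⟪f, g⟫ = φ (f* g)`. -/
@[reducible] def preCore : PreInnerProductSpace.Core ℂ R where
  inner f g := φ.toLinearMap (star f * g)
  conj_inner_symm f g := by
    have h := φ.map_star' (star g * f)
    simp only [star_mul, star_star] at h
    exact h.symm
  re_inner_nonneg f := (Complex.le_def.1 (φ.nonneg' f)).1
  add_left f g h := by simp [add_mul]
  smul_left f g c := by simp [star_smul]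

theorem seminorm_eq_zero_iff (a : R) : φ.seminorm a = 0 ↔ φ.toLinearMap (star a * a) = 0 := by
  have h : 0 ≤ (φ.toLinearMap (star a * a)).re ∧ 0 = (φ.toLinearMap (star a * a)).im :=
    Complex.le_def.1 (φ.nonneg' a)
  rw [seminorm, Real.sqrt_eq_zero h.1, Complex.ext_iff]
  exact ⟨fun h0 => ⟨h0, h.2.symm⟩, fun h0 => h0.1⟩

theorem apply_star_mul_eq_zero {a : R} (ha : φ.toLinearMap (star a * a) = 0) (b : R) :
    φ.toLinearMap (star b * a) = 0 := by
  let _ := φ.preCore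
  have h : ‖φ.toLinearMap (star b * a)‖ * ‖φ.toLinearMap (star a * b)‖ ≤
      (φ.toLinearMap (star b * b)).re * (φ.toLinearMap (star a * a)).re :=
    InnerProductSpace.Core.inner_mul_inner_self_le (𝕜 := ℂ) b a
  have h2 : ‖φ.toLinearMap (star a * b)‖ = ‖φ.toLinearMap (star b * a)‖ := by
    have := φ.map_star' (star b * a)
    simp only [star_mul, star_star] at this
    exact (congrArg norm this).trans (norm_star _)
  rw [h2, ha, Complex.zero_re, mul_zero] at h
  exact norm_eq_zero.1 (mul_self_eq_zero.1 (le_antisymm h (mul_self_nonneg _)))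

/-- The Gel'fand ideal: the elements `a` with `‖a‖_φ = 0`. -/
def gelfandIdeal : Submodule ℂ R where
  carrier := {a | φ.seminorm a = 0}
  zero_mem' := by simp [seminorm]
  add_mem' {a b} ha hb := by
    rw [Set.mem_ofPred_eq, seminorm_eq_zero_iff] at *
    rw [mul_add, map_add, φ.apply_star_mul_eq_zero ha, φ.apply_star_mul_eq_zero hb, add_zero]
  smul_mem' c a ha := by
    rw [Set.mem_ofPred_eq, seminorm_eq_zero_iff] at *
    rw [mul_smul_comm, map_smul, φ.apply_star_mul_eq_zero ha, smul_zero]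

theorem mem_gelfandIdeal {a : R} : a ∈ φ.gelfandIdeal ↔ φ.toLinearMap (star a * a) = 0 :=
  φ.seminorm_eq_zero_iff a

theorem mul_mem_gelfandIdeal (a : R) {b : R} (hb : b ∈ φ.gelfandIdeal) :
    a * b ∈ φ.gelfandIdeal := by
  rw [mem_gelfandIdeal] at *
  have h := φ.apply_star_mul_eq_zero hb (star a * (a * b))
  simpa [mul_assoc] using h

/-- The quotient of `R` by the Gel'fand ideal. -/
def Quot : Type _ := R ⧸ φ.gelfandIdeal

instance : AddCommGroup φ.Quot := inferInstanceAs (AddCommGroup (R ⧸ φ.gelfandIdeal))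

instance : Module ℂ φ.Quot := inferInstanceAs (Module ℂ (R ⧸ φ.gelfandIdeal))

/-- The canonical projection onto the quotient by the Gel'fand ideal. -/
def toQuot : R →ₗ[ℂ] φ.Quot := φ.gelfandIdeal.mkQ

theorem toQuot_surjective : Function.Surjective φ.toQuot := φ.gelfandIdeal.mkQ_surjective

/-- The inner product `⟪[f], [g]⟫ = φ (f* g)` on the quotient by the Gel'fand ideal. -/
def quotInner (x y : φ.Quot) : ℂ :=
  Quotient.liftOn₂' x y (fun f g => φ.toLinearMap (star f * g)) (by
    intro f g f' g' hf hg
    rw [Submodule.quotientRel_def] at hf hg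
    have h1 := φ.apply_star_mul_eq_zero (φ.mem_gelfandIdeal.1 hg) f
    have h2 := φ.apply_star_mul_eq_zero (φ.mem_gelfandIdeal.1 hf) g'
    have h3 := φ.map_star' (star g' * (f - f'))
    simp only [star_mul, star_star] at h3
    have h4 : φ.toLinearMap (star (f - f') * g') = 0 := by
      refine h3.trans ?_
      rw [show φ.toFun (star g' * (f - f')) = 0 from h2, star_zero]
    rw [mul_sub, map_sub, sub_eq_zero] at h1
    rw [star_sub, sub_mul, map_sub, sub_eq_zero] at h4
    exact h1.trans h4)

theorem quotInner_toQuot (f g : R) :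
    φ.quotInner (φ.toQuot f) (φ.toQuot g) = φ.toLinearMap (star f * g) := rfl

/-- The quotient by the Gel'fand ideal is a pre-Hilbert space. -/
@[reducible] def quotCore : InnerProductSpace.Core ℂ φ.Quot where
  inner := φ.quotInner
  conj_inner_symm x y := by
    obtain ⟨f, rfl⟩ := φ.toQuot_surjective x
    obtain ⟨g, rfl⟩ := φ.toQuot_surjective y
    exact φ.preCore.conj_inner_symm f g
  re_inner_nonneg x := by
    obtain ⟨f, rfl⟩ := φ.toQuot_surjective x
    exact φ.preCore.re_inner_nonneg f
  add_left x y z := by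
    obtain ⟨f, rfl⟩ := φ.toQuot_surjective x
    obtain ⟨g, rfl⟩ := φ.toQuot_surjective y
    obtain ⟨h, rfl⟩ := φ.toQuot_surjective z
    exact φ.preCore.add_left f g h
  smul_left x y c := by
    obtain ⟨f, rfl⟩ := φ.toQuot_surjective x
    obtain ⟨g, rfl⟩ := φ.toQuot_surjective y
    exact φ.preCore.smul_left f g c
  definite x hx := by
    obtain ⟨f, rfl⟩ := φ.toQuot_surjective x
    exact (Submodule.Quotient.mk_eq_zero _).2 (φ.mem_gelfandIdeal.2 hx)

instance : NormedAddCommGroup φ.Quot := φ.quotCore.toNormedAddCommGroup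

instance : InnerProductSpace ℂ φ.Quot := InnerProductSpace.ofCore φ.quotCore.toCore

/-- The Hilbert space of the GNS representation: the completion of the quotient by the Gel'fand
ideal. -/
abbrev GNSSpace : Type _ := UniformSpace.Completion φ.Quot

/-- Left multiplication `[b] ↦ [a b]` on the quotient by the Gel'fand ideal. -/
def quotMul (a : R) : φ.Quot →ₗ[ℂ] φ.Quot :=
  φ.gelfandIdeal.mapQ φ.gelfandIdeal (LinearMap.mulLeft ℂ a)
    (fun _ hb => φ.mul_mem_gelfandIdeal a hb)

theorem quotMul_toQuot (a b : R) : φ.quotMul a (φ.toQuot b) = φ.toQuot (a * b) := rfl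

/-- The embedding of the quotient by the Gel'fand ideal in its completion. -/
def quotEmb : φ.Quot →ₗ[ℂ] φ.GNSSpace :=
  (UniformSpace.Completion.toComplₗᵢ (𝕜 := ℂ) (E := φ.Quot)).toLinearMap

theorem quotEmb_injective : Function.Injective φ.quotEmb :=
  (UniformSpace.Completion.toComplₗᵢ (𝕜 := ℂ) (E := φ.Quot)).injective

/-- The multiplication operator by `a` in the GNS representation: the unbounded operator
`[b] ↦ [a b]` on the Hilbert space, whose domain is the (dense) quotient by the Gel'fand ideal. -/
def gnsMul (a : R) : φ.GNSSpace →ₗ.[ℂ] φ.GNSSpace where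
  domain := LinearMap.range φ.quotEmb
  toFun := φ.quotEmb ∘ₗ φ.quotMul a ∘ₗ
    (LinearEquiv.ofInjective φ.quotEmb φ.quotEmb_injective).symm.toLinearMap

end PosHermMap

end StarAlgebra

/-- An unbounded operator `T` on a Hilbert space is essentially self-adjoint if it is densely
defined and symmetric and the domain of its closure is the domain of its adjoint. -/
def IsEssentiallySelfAdjoint {H : Type*} [NormedAddCommGroup H] [InnerProductSpace ℂ H]
    [CompleteSpace H] (T : H →ₗ.[ℂ] H) : Prop :=
  Dense (T.domain : Set H) ∧ T.IsFormalAdjoint T ∧ T.closure.domain = T.adjoint.domain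

/-! ## Complexification -/

section Complexification

variable {X : Type*} [TopologicalSpace X]

/-- A real-valued continuous function as a complex-valued one. -/
def toComplexFun (f : C(X, ℝ)) : C(X, ℂ) := ⟨fun x => (f x : ℂ), by fun_prop⟩

/-- The real part of a continuous complex-valued function. -/
def reFun (f : C(X, ℂ)) : C(X, ℝ) := ⟨fun x => (f x).re, by fun_prop⟩

/-- The imaginary part of a continuous complex-valued function. -/
def imFun (f : C(X, ℂ)) : C(X, ℝ) := ⟨fun x => (f x).im, by fun_prop⟩

theorem eq_add_I_smul_iff (f : C(X, ℂ)) (u v : C(X, ℝ)) :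
    f = toComplexFun u + Complex.I • toComplexFun v ↔ u = reFun f ∧ v = imFun f := by
  constructor
  · rintro rfl
    constructor <;> ext x <;> simp [toComplexFun, reFun, imFun]
  · rintro ⟨rfl, rfl⟩
    ext x
    simp [toComplexFun, reFun, imFun, mul_comm Complex.I, Complex.re_add_im]

/-- The complexification `{u + i v | u, v ∈ B}` of a unital subalgebra `B` of `C(X, ℝ)`, which is a
unital `*`-subalgebra of `C(X, ℂ)`. -/
def complexify (B : Subalgebra ℝ C(X, ℝ)) : StarSubalgebra ℂ C(X, ℂ) where
  carrier := {f | ∃ u ∈ B, ∃ v ∈ B, f = toComplexFun u + Complex.I • toComplexFun v}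
  mul_mem' := by
    rintro _ _ ⟨u, hu, v, hv, rfl⟩ ⟨u', hu', v', hv', rfl⟩
    refine ⟨u * u' - v * v', sub_mem (mul_mem hu hu') (mul_mem hv hv'),
      u * v' + v * u', add_mem (mul_mem hu hv') (mul_mem hv hu'), ?_⟩
    ext x
    simp only [toComplexFun, ContinuousMap.mul_apply, ContinuousMap.add_apply,
      ContinuousMap.smul_apply, ContinuousMap.coe_mk, ContinuousMap.sub_apply, smul_eq_mul]
    push_cast
    linear_combination (v x * v' x : ℂ) * Complex.I_sq
  add_mem' := by
    rintro _ _ ⟨u, hu, v, hv, rfl⟩ ⟨u', hu', v', hv', rfl⟩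
    refine ⟨u + u', add_mem hu hu', v + v', add_mem hv hv', ?_⟩
    ext x
    simp only [toComplexFun, ContinuousMap.add_apply,
      ContinuousMap.smul_apply, ContinuousMap.coe_mk, smul_eq_mul]
    push_cast
    ring
  algebraMap_mem' c := by
    refine ⟨algebraMap ℝ _ c.re, B.algebraMap_mem _, algebraMap ℝ _ c.im, B.algebraMap_mem _, ?_⟩
    ext x
    simp [toComplexFun, mul_comm Complex.I, Complex.re_add_im]
  star_mem' := by
    rintro _ ⟨u, hu, v, hv, rfl⟩
    refine ⟨u, hu, -v, neg_mem hv, ?_⟩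
    ext x
    simp [toComplexFun]

theorem mem_complexify_iff (B : Subalgebra ℝ C(X, ℝ)) (f : C(X, ℂ)) :
    f ∈ complexify B ↔ reFun f ∈ B ∧ imFun f ∈ B := by
  constructor
  · rintro ⟨u, hu, v, hv, h⟩
    obtain ⟨rfl, rfl⟩ := (eq_add_I_smul_iff f u v).1 h
    exact ⟨hu, hv⟩
  · rintro ⟨hu, hv⟩
    exact ⟨_, hu, _, hv, (eq_add_I_smul_iff f _ _).2 ⟨rfl, rfl⟩⟩

/-- The complexification of a unital subalgebra `I` of `C(X, ℝ)`, as a commutative unital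
`*`-algebra. -/
def ComplexAlg (I : Subalgebra ℝ C(X, ℝ)) : Type _ := complexify I

instance (I : Subalgebra ℝ C(X, ℝ)) : CommRing (ComplexAlg I) :=
  inferInstanceAs (CommRing (complexify I))

instance (I : Subalgebra ℝ C(X, ℝ)) : StarRing (ComplexAlg I) :=
  inferInstanceAs (StarRing (complexify I))

instance (I : Subalgebra ℝ C(X, ℝ)) : Algebra ℂ (ComplexAlg I) :=
  inferInstanceAs (Algebra ℂ (complexify I))

instance (I : Subalgebra ℝ C(X, ℝ)) : StarModule ℂ (ComplexAlg I) :=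
  inferInstanceAs (StarModule ℂ (complexify I))

/-- The inclusion of the complexification of `I` in `C(X, ℂ)`. -/
def ComplexAlg.val (I : Subalgebra ℝ C(X, ℝ)) : ComplexAlg I →⋆ₐ[ℂ] C(X, ℂ) :=
  (complexify I).subtype

theorem ComplexAlg.val_injective (I : Subalgebra ℝ C(X, ℝ)) :
    Function.Injective (ComplexAlg.val I) := Subtype.val_injective

theorem ComplexAlg.val_mem (I : Subalgebra ℝ C(X, ℝ)) (f : ComplexAlg I) :
    ComplexAlg.val I f ∈ complexify I := Subtype.property f

/-- The real part of an element of the complexification of `I`. -/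
def ComplexAlg.re {I : Subalgebra ℝ C(X, ℝ)} (f : ComplexAlg I) : I :=
  ⟨reFun (ComplexAlg.val I f), ((mem_complexify_iff I _).1 (ComplexAlg.val_mem I f)).1⟩

/-- The imaginary part of an element of the complexification of `I`. -/
def ComplexAlg.im {I : Subalgebra ℝ C(X, ℝ)} (f : ComplexAlg I) : I :=
  ⟨imFun (ComplexAlg.val I f), ((mem_complexify_iff I _).1 (ComplexAlg.val_mem I f)).2⟩

/-- An element of `I`, regarded as an element of the complexification of `I`. -/
def embComplexify {I : Subalgebra ℝ C(X, ℝ)} (f : I) : ComplexAlg I :=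
  ⟨toComplexFun f, f, f.2, 0, I.zero_mem, by ext x; simp [toComplexFun]⟩

theorem val_embComplexify {I : Subalgebra ℝ C(X, ℝ)} (f : I) :
    ComplexAlg.val I (embComplexify f) = toComplexFun f := rfl

/-- For a unital subalgebra `A` of `I`, the complex span `{u + i v | u, v ∈ A}` of `A`, as a unital
`*`-subalgebra of the complexification of `I`. -/
def complexifySub {I : Subalgebra ℝ C(X, ℝ)} (A : Subalgebra ℝ I) :
    StarSubalgebra ℂ (ComplexAlg I) :=
  (complexify (A.map I.val)).comap (ComplexAlg.val I)

theorem embComplexify_mem {I : Subalgebra ℝ C(X, ℝ)} {A : Subalgebra ℝ I} {a : I} (ha : a ∈ A) :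
    embComplexify a ∈ complexifySub A :=
  ⟨a, ⟨a, ha, rfl⟩, 0, zero_mem _, by
    change ComplexAlg.val I (embComplexify a) = _
    rw [val_embComplexify]; ext x; simp [toComplexFun]⟩

theorem coe_complexifySub {I : Subalgebra ℝ C(X, ℝ)} (A : Subalgebra ℝ I) :
    (complexifySub A : Set (ComplexAlg I)) =
      Submodule.span ℂ (embComplexify '' (A : Set I)) := by
  apply Set.Subset.antisymm
  · rintro f ⟨_, ⟨u, hu, rfl⟩, _, ⟨v, hv, rfl⟩, h⟩
    have : f = embComplexify u + Complex.I • embComplexify v := Subtype.ext h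
    rw [this]
    exact add_mem (Submodule.subset_span ⟨u, hu, rfl⟩)
      (Submodule.smul_mem _ _ (Submodule.subset_span ⟨v, hv, rfl⟩))
  · have h : Submodule.span ℂ (embComplexify '' (A : Set I)) ≤
        Subalgebra.toSubmodule (complexifySub A).toSubalgebra := by
      rw [Submodule.span_le]
      rintro _ ⟨a, ha, rfl⟩
      exact embComplexify_mem ha
    exact h

/-- The complex-linear extension `Φ_ℂ (u + i v) = Φ u + i Φ v` of a positive linear functional `Φ`
on `I` to the complexification of `I`. -/
def complexifyMap {I : Subalgebra ℝ C(X, ℝ)} (Φ : I →ₚ[ℝ] ℝ) : PosHermMap (ComplexAlg I) where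
  toFun f := (Φ f.re : ℂ) + Complex.I * (Φ f.im : ℂ)
  map_add' f g := by
    have h1 : (f + g).re = f.re + g.re := by
      ext x; simp [ComplexAlg.re, reFun]
    have h2 : (f + g).im = f.im + g.im := by
      ext x; simp [ComplexAlg.im, imFun]
    rw [h1, h2, map_add, map_add]
    push_cast
    ring
  map_smul' c f := by
    have h1 : (c • f).re = c.re • f.re - c.im • f.im := by
      ext x; simp [ComplexAlg.re, ComplexAlg.im, reFun, imFun]
    have h2 : (c • f).im = c.re • f.im + c.im • f.re := by
      ext x; simp [ComplexAlg.re, ComplexAlg.im, reFun, imFun]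
    rw [h1, h2, map_sub, map_add, map_smul, map_smul, map_smul, map_smul]
    apply Complex.ext <;> simp
  map_star' f := by
    have h1 : (star f).re = f.re := by
      ext x; simp [ComplexAlg.re, reFun, map_star]
    have h2 : (star f).im = -f.im := by
      ext x; simp [ComplexAlg.im, imFun, map_star]
    simp only [h1, h2, map_neg]
    apply Complex.ext <;> simp
  nonneg' f := by
    have h1 : (0 : I) ≤ (star f * f).re := by
      intro x
      have h : (0 : ℝ) ≤ (star (ComplexAlg.val I f x) * ComplexAlg.val I f x).re := by
        rw [Complex.star_def, ← Complex.normSq_eq_conj_mul_self, Complex.ofReal_re]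
        exact Complex.normSq_nonneg _
      exact h
    have h2 : (star f * f).im = 0 := by
      ext x; simp [ComplexAlg.im, imFun, map_star]; ring
    have h3 : 0 ≤ Φ _ := map_nonneg Φ h1
    simp only [h2, map_zero]
    simpa using h3

theorem complexifyMap_emb {I : Subalgebra ℝ C(X, ℝ)} (Φ : I →ₚ[ℝ] ℝ) (f : I) :
    (complexifyMap Φ).toLinearMap (embComplexify f) = (Φ f : ℂ) := by
  have h1 : (embComplexify f).re = f := by
    ext x; simp [ComplexAlg.re, val_embComplexify, reFun, toComplexFun]
  have h2 : (embComplexify f).im = 0 := by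
    ext x; simp [ComplexAlg.im, val_embComplexify, imFun, toComplexFun]
  change (Φ (embComplexify f).re : ℂ) + Complex.I * (Φ (embComplexify f).im : ℂ) = _
  rw [h1, h2]
  simp

end Complexification

end

/-!
Two observations carry the proof, and both avoid representing `Φ` as an integral.

*Essential self-adjointness is density of the ranges of `a ± i`.* A densely defined symmetric
operator `T` is essentially self-adjoint if and only if `T + i` and `T - i` have dense range
(`LinearPMap.IsFormalAdjoint.isEssentiallySelfAdjoint_of_dense`,
`IsEssentiallySelfAdjoint.dense_range_add_smul`). For the GNS operator of `a` this is a condition on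
`‖·‖_φ` alone: every `b` in the algebra is approximated by elements `(a ± i) c`
(`PosHermMap.isEssentiallySelfAdjoint_gnsMul_iff`). Since `a` is Hermitian, `‖(a ± i) g‖_φ` is the
graph seminorm of `g` (`PosHermMap.seminorm_mul_add_smul`). If the graph closure of the subalgebra is
everything, one approximates `(a ± i)⁻¹ b`, which lies in the complexification because `I` is a Riesz
ideal, by elements `c` of the subalgebra in the graph seminorm; then `(a ± i) c` approximates `b`.
Conversely, if the subalgebra is dense for `‖·‖_φ` and `a` is essentially self-adjoint on it, then
`(a + i) g` is approximated by elements `(a + i) c`, so `g` is approximated by `c` in the graph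
seminorm.

*Essential self-adjointness for all `a ∈ S` forces density.* It makes the closure of the subalgebra
invariant under the resolvents `(a ± i)⁻¹`, hence under the bounded functions `(a² + 1)⁻¹` and
`a (a² + 1)⁻¹` (`mul_mem_closure_of_isEssentiallySelfAdjoint`). The algebra of all bounded functions
in `I` which multiply the closure into itself therefore separates points, and it is contained in the
closure because `1` is. Such an algebra is dense in `I`
(`IsStrictlyContinuous.exists_bounded_seminorm_sub_lt`,
`IsStrictlyContinuous.exists_mem_seminorm_sub_lt`): the space is `σ`-compact, so strict continuity
makes `Φ` small on cutoff functions supported far out (`IsStrictlyContinuous.exists_cutoff`), and on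
the remaining compact set the Stone–Weierstrass theorem applies, combined with a polynomial
approximation of a truncation to control the sup norm.
-/

/-! ### A criterion for essential self-adjointness -/

theorem Complex.star_eq_neg_of_mul_self_eq_neg_one {z : ℂ} (hz : z * z = -1) : star z = -z := by
  have h : (z - Complex.I) * (z + Complex.I) = 0 := by
    linear_combination hz - Complex.I_mul_I
  rcases mul_eq_zero.1 h with h | h
  · rw [sub_eq_zero.1 h]; simp
  · rw [eq_neg_of_add_eq_zero_left h]; simp

namespace LinearPMap

variable {H : Type*} [NormedAddCommGroup H] [InnerProductSpace ℂ H] {T : H →ₗ.[ℂ] H}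

/-- For symmetric `T` and `z = ± i`, the cross terms of `‖(T + z) c‖²` cancel. -/
theorem IsFormalAdjoint.norm_add_smul_sq (hs : T.IsFormalAdjoint T) {z : ℂ} (hz : z * z = -1)
    (c : T.domain) : ‖T c + z • (c : H)‖ ^ 2 = ‖T c‖ ^ 2 + ‖(c : H)‖ ^ 2 := by
  have hst := Complex.star_eq_neg_of_mul_self_eq_neg_one hz
  have h1 : inner ℂ (T c + z • (c : H)) (T c + z • (c : H)) =
      inner ℂ (T c) (T c) + inner ℂ (c : H) (c : H) := by
    simp only [inner_add_left, inner_add_right, inner_smul_left, inner_smul_right]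
    rw [← starRingEnd_apply] at hst
    rw [hst, hs c c]
    linear_combination (-inner ℂ (c : H) (c : H)) * hz
  have h2 := congrArg Complex.re h1
  simpa [inner_self_eq_norm_sq_to_K, ← Complex.ofReal_pow] using h2

variable [CompleteSpace H]

theorem IsFormalAdjoint.isClosable (hd : Dense (T.domain : Set H)) (hs : T.IsFormalAdjoint T) :
    T.IsClosable :=
  (adjoint_isClosed hd).isClosable.leIsClosable (hs.le_adjoint hd)

theorem IsFormalAdjoint.closure_le_adjoint (hd : Dense (T.domain : Set H))
    (hs : T.IsFormalAdjoint T) : T.closure ≤ T.adjoint := by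
  apply le_of_le_graph
  rw [← (hs.isClosable hd).graph_closure_eq_closure_graph]
  exact Submodule.topologicalClosure_minimal _ (le_graph_of_le (hs.le_adjoint hd))
    (adjoint_isClosed hd)

/-- For `x` in the domain of the adjoint, density of the range of `T + i` and completeness give `y`
in the domain of the closure with `(T† + i) y = (T† + i) x`; then `x - y` is orthogonal to the
range of `T - i`, hence `x = y`. -/
theorem IsFormalAdjoint.isEssentiallySelfAdjoint_of_dense (hd : Dense (T.domain : Set H))
    (hs : T.IsFormalAdjoint T)
    (h : ∀ z : ℂ, z * z = -1 → DenseRange fun c : T.domain => T c + z • (c : H)) :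
    IsEssentiallySelfAdjoint T := by
  refine ⟨hd, hs, le_antisymm (hs.closure_le_adjoint hd).1 fun x hx => ?_⟩
  set w : H := T.adjoint ⟨x, hx⟩ + Complex.I • x with hw
  obtain ⟨u', hu', hlim⟩ := mem_closure_iff_seq_limit.1 (h _ Complex.I_mul_I w)
  choose u hu using hu'
  have hu'' : u' = fun n => T (u n) + Complex.I • (u n : H) := funext fun n => (hu n).symm
  rw [hu''] at hlim
  -- The graph norm of `u m - u n` is the norm of `(T + i) (u m - u n)`, so `u` is Cauchy.
  have hcau : CauchySeq fun n => (u n : H) := by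
    have hc := hlim.cauchySeq
    rw [Metric.cauchySeq_iff] at hc ⊢
    intro ε hε
    obtain ⟨N, hN⟩ := hc ε hε
    refine ⟨N, fun m hm n hn => lt_of_le_of_lt ?_ (hN m hm n hn)⟩
    have h1 := hs.norm_add_smul_sq Complex.I_mul_I (u m - u n)
    rw [dist_eq_norm, dist_eq_norm]
    have h2 : T (u m) + Complex.I • (u m : H) - (T (u n) + Complex.I • (u n : H)) =
        T (u m - u n) + Complex.I • ((u m - u n : T.domain) : H) := by
      rw [map_sub, Submodule.coe_sub, smul_sub]; abel
    rw [h2]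
    refine le_of_sq_le_sq ?_ (norm_nonneg _)
    rw [h1, Submodule.coe_sub]
    exact le_add_of_nonneg_left (sq_nonneg _)
  obtain ⟨y, hy⟩ := cauchySeq_tendsto_of_complete hcau
  have hTy : Filter.Tendsto (fun n => T (u n)) Filter.atTop (nhds (w - Complex.I • y)) := by
    simpa using hlim.sub (hy.const_smul Complex.I)
  have hmem : (y, w - Complex.I • y) ∈ T.closure.graph := by
    rw [← (hs.isClosable hd).graph_closure_eq_closure_graph]
    exact mem_closure_of_tendsto (hy.prodMk_nhds hTy) (Filter.Eventually.of_forall fun n => by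
      exact T.mem_graph (u n))
  have hyd : y ∈ T.closure.domain := by
    obtain ⟨y', h1, -⟩ := (mem_graph_iff _).1 hmem
    exact (show (y' : H) = y from h1) ▸ y'.2
  have hmem' := le_graph_of_le (hs.closure_le_adjoint hd) hmem
  obtain ⟨⟨y', hy'⟩, h1, h2⟩ := (mem_graph_iff _).1 hmem'
  obtain rfl : y' = y := h1
  suffices hxy : x - y' = 0 by rwa [sub_eq_zero.1 hxy]
  have hz : (-Complex.I) * (-Complex.I) = (-1 : ℂ) := by simp
  refine (h _ hz).eq_zero_of_inner_left ℂ ?_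
  intro c
  have h3 := adjoint_isFormalAdjoint hd (⟨x, hx⟩ - ⟨y', hy'⟩) c
  have h4 : T.adjoint (⟨x, hx⟩ - ⟨y', hy'⟩) = -(Complex.I • (x - y')) := by
    rw [map_sub, h2, hw]; module
  rw [h4] at h3
  simp only [inner_add_right, inner_smul_right]
  rw [← show inner ℂ _ (c : H) = inner ℂ (x - y') (T c) from h3, inner_neg_left, inner_smul_left]
  simp

/-- A vector orthogonal to the range of `T + z`, with `z = ± i`, is an eigenvector of the adjoint
for the eigenvalue `z`; this cannot be in the domain of the closure, which is symmetric. -/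
theorem _root_.IsEssentiallySelfAdjoint.dense_range_add_smul (h : IsEssentiallySelfAdjoint T)
    {z : ℂ} (hz : z * z = -1) : DenseRange fun c : T.domain => T c + z • (c : H) := by
  obtain ⟨hd, hs, he⟩ := h
  have hst := Complex.star_eq_neg_of_mul_self_eq_neg_one hz
  rw [← starRingEnd_apply] at hst
  have hr : (Set.range fun c : T.domain => T c + z • (c : H)) =
      (LinearMap.range (T.toFun + z • T.domain.subtype) : Set H) := rfl
  rw [DenseRange, hr, Submodule.dense_iff_topologicalClosure_eq_top,
    Submodule.topologicalClosure_eq_top_iff, Submodule.eq_bot_iff]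
  intro y hy
  have h1 : ∀ c : T.domain, inner ℂ (z • y) (c : H) = inner ℂ y (T c) := by
    intro c
    have h2 := Submodule.inner_left_of_mem_orthogonal (LinearMap.mem_range_self
      (T.toFun + z • T.domain.subtype) c) hy
    have h3 : inner ℂ y (T c) + z * inner ℂ y (c : H) = 0 := by
      rw [← inner_smul_right, ← inner_add_right]
      exact h2
    rw [inner_smul_left, hst]
    linear_combination -h3
  have hyd : y ∈ T.adjoint.domain := mem_adjoint_domain_of_exists y ⟨_, h1⟩
  have hya : T.adjoint ⟨y, hyd⟩ = z • y := adjoint_apply_eq hd _ h1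
  have hyc : y ∈ T.closure.domain := he ▸ hyd
  have hyv : T.closure ⟨y, hyc⟩ = z • y :=
    ((hs.closure_le_adjoint hd).2 (x := ⟨y, hyc⟩) (y := ⟨y, hyd⟩) rfl).trans hya
  have hmem : (y, z • y) ∈ T.graph.topologicalClosure := by
    rw [(hs.isClosable hd).graph_closure_eq_closure_graph, ← hyv]
    exact T.closure.mem_graph ⟨y, hyc⟩
  -- The identity `⟪T c, c⟫ = ⟪c, T c⟫` extends to the closure of the graph.
  have hclosed : _root_.IsClosed {p : H × H | inner ℂ p.2 p.1 = inner ℂ p.1 p.2} :=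
    isClosed_eq (by fun_prop) (by fun_prop)
  have hsub : (T.graph : Set (H × H)) ⊆ {p : H × H | inner ℂ p.2 p.1 = inner ℂ p.1 p.2} := by
    rintro ⟨p, q⟩ hp
    obtain ⟨c, rfl, rfl⟩ := (mem_graph_iff _).1 hp
    exact hs c c
  have h4 : inner ℂ (z • y) y = inner ℂ y (z • y) := closure_minimal hsub hclosed hmem
  rw [inner_smul_left, inner_smul_right, hst] at h4
  have hz0 : z ≠ 0 := by
    rintro rfl
    simp at hz
  have h5 : z * inner ℂ y y = 0 := by linear_combination (-1 / 2 : ℂ) * h4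
  exact inner_self_eq_zero.1 ((mul_eq_zero.1 h5).resolve_left hz0)

end LinearPMap

/-! ### Essential self-adjointness in the GNS representation -/

namespace PosHermMap

section Seminorm

variable {R : Type*} [Ring R] [StarRing R] [Algebra ℂ R] [StarModule ℂ R] (φ : PosHermMap R)

theorem seminorm_nonneg (f : R) : 0 ≤ φ.seminorm f := Real.sqrt_nonneg _

theorem seminorm_sq (f : R) : φ.seminorm f ^ 2 = (φ.toLinearMap (star f * f)).re :=
  Real.sq_sqrt (Complex.le_def.1 (φ.nonneg' f)).1

theorem seminorm_add_le (f g : R) : φ.seminorm (f + g) ≤ φ.seminorm f + φ.seminorm g :=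
  let c := φ.preCore
  @norm_add_le R (@InnerProductSpace.Core.toSeminormedAddCommGroup ℂ R _ _ _ c).toSeminormedAddGroup
    f g

theorem seminorm_smul (z : ℂ) (f : R) : φ.seminorm (z • f) = ‖z‖ * φ.seminorm f := by
  have h : φ.seminorm (z • f) ^ 2 = (‖z‖ * φ.seminorm f) ^ 2 := by
    rw [mul_pow, seminorm_sq, seminorm_sq, star_smul, smul_mul_smul_comm, map_smul, smul_eq_mul,
      Complex.star_def, ← Complex.normSq_eq_conj_mul_self, Complex.re_ofReal_mul,
      Complex.normSq_eq_norm_sq]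
  exact (sq_eq_sq₀ (φ.seminorm_nonneg _)
    (mul_nonneg (norm_nonneg _) (φ.seminorm_nonneg _))).1 h

theorem seminorm_zero : φ.seminorm 0 = 0 := by simp [seminorm]

theorem seminorm_sub_lt {f g h : R} {ε : ℝ} (h1 : φ.seminorm (f - g) < ε / 2)
    (h2 : φ.seminorm (g - h) < ε / 2) : φ.seminorm (f - h) < ε := by
  have := φ.seminorm_add_le (f - g) (g - h)
  rw [sub_add_sub_cancel] at this
  linarith

theorem seminorm_restrict (𝒜 : StarSubalgebra ℂ R) (f : 𝒜) :
    (φ.restrict 𝒜).seminorm f = φ.seminorm (f : R) := rfl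

/-- For Hermitian `a` and `z = ± i`, the cross terms of `‖(a + z) g‖²` cancel. -/
theorem seminorm_mul_add_smul {a : R} (ha : star a = a) {z : ℂ} (hz : z * z = -1) (g : R) :
    φ.seminorm (a * g + z • g) = φ.graphSeminorm a g := by
  have h : star (a * g + z • g) * (a * g + z • g) = star (a * g) * (a * g) + star g * g := by
    rw [star_add, star_mul, ha, star_smul, Complex.star_eq_neg_of_mul_self_eq_neg_one hz]
    simp only [add_mul, mul_add, smul_mul_assoc, mul_smul_comm, smul_smul, neg_smul, neg_mul, hz,
      mul_assoc, smul_neg, smul_add]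
    rw [one_smul]
    abel
  rw [graphSeminorm, seminorm_sq, seminorm_sq, seminorm, h, map_add, Complex.add_re]

theorem seminorm_le_graphSeminorm (a g : R) : φ.seminorm g ≤ φ.graphSeminorm a g :=
  Real.le_sqrt_of_sq_le (le_add_of_nonneg_left (sq_nonneg _))

theorem norm_quotEmb_toQuot (f : R) : ‖φ.quotEmb (φ.toQuot f)‖ = φ.seminorm f :=
  UniformSpace.Completion.norm_coe (φ.toQuot f)

theorem inner_quotEmb_toQuot (f g : R) :
    inner ℂ (φ.quotEmb (φ.toQuot f)) (φ.quotEmb (φ.toQuot g)) = φ.toLinearMap (star f * g) :=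
  UniformSpace.Completion.inner_coe (φ.toQuot f) (φ.toQuot g)

theorem denseRange_quotEmb_toQuot : DenseRange fun f => φ.quotEmb (φ.toQuot f) :=
  (UniformSpace.Completion.denseRange_coe (α := φ.Quot)).comp φ.toQuot_surjective.denseRange
    (UniformSpace.Completion.continuous_coe _)

theorem mem_gnsMul_domain (a b : R) : φ.quotEmb (φ.toQuot b) ∈ (φ.gnsMul a).domain :=
  ⟨φ.toQuot b, rfl⟩

theorem gnsMul_apply (a b : R) :
    φ.gnsMul a ⟨φ.quotEmb (φ.toQuot b), φ.mem_gnsMul_domain a b⟩ =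
      φ.quotEmb (φ.toQuot (a * b)) := by
  have h : (LinearEquiv.ofInjective φ.quotEmb φ.quotEmb_injective).symm
      ⟨φ.quotEmb (φ.toQuot b), φ.mem_gnsMul_domain a b⟩ = φ.toQuot b :=
    (LinearEquiv.ofInjective φ.quotEmb φ.quotEmb_injective).symm_apply_apply (φ.toQuot b)
  exact congrArg (fun x => φ.quotEmb (φ.quotMul a x)) h

theorem exists_eq_quotEmb_toQuot {a : R} (x : (φ.gnsMul a).domain) :
    ∃ b, x = ⟨φ.quotEmb (φ.toQuot b), φ.mem_gnsMul_domain a b⟩ := by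
  obtain ⟨_, q, rfl⟩ := x
  obtain ⟨b, rfl⟩ := φ.toQuot_surjective q
  exact ⟨b, rfl⟩

theorem dense_gnsMul_domain (a : R) : Dense ((φ.gnsMul a).domain : Set φ.GNSSpace) :=
  φ.denseRange_quotEmb_toQuot.mono (by rintro _ ⟨b, rfl⟩; exact φ.mem_gnsMul_domain a b)

theorem gnsMul_isFormalAdjoint {a : R} (ha : star a = a) :
    (φ.gnsMul a).IsFormalAdjoint (φ.gnsMul a) := by
  intro x y
  obtain ⟨b, rfl⟩ := φ.exists_eq_quotEmb_toQuot x
  obtain ⟨c, rfl⟩ := φ.exists_eq_quotEmb_toQuot y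
  rw [gnsMul_apply, gnsMul_apply, inner_quotEmb_toQuot, inner_quotEmb_toQuot, star_mul, ha,
    mul_assoc]

theorem denseRange_gnsMul_add_smul_iff (a : R) (z : ℂ) :
    (DenseRange fun x : (φ.gnsMul a).domain => φ.gnsMul a x + z • (x : φ.GNSSpace)) ↔
      ∀ b : R, ∀ ε : ℝ, 0 < ε → ∃ c : R, φ.seminorm (b - (a * c + z • c)) < ε := by
  have key : ∀ b c : R, dist (φ.quotEmb (φ.toQuot b))
      (φ.gnsMul a ⟨φ.quotEmb (φ.toQuot c), φ.mem_gnsMul_domain a c⟩ +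
        z • φ.quotEmb (φ.toQuot c)) = φ.seminorm (b - (a * c + z • c)) := by
    intro b c
    rw [gnsMul_apply, dist_eq_norm, ← norm_quotEmb_toQuot]
    simp only [map_sub, map_add, map_smul]
  constructor
  · intro h b ε hε
    obtain ⟨x, hx⟩ := h.exists_dist_lt (φ.quotEmb (φ.toQuot b)) hε
    obtain ⟨c, rfl⟩ := φ.exists_eq_quotEmb_toQuot x
    exact ⟨c, key b c ▸ hx⟩
  · intro h
    rw [DenseRange, ← dense_closure]
    refine φ.denseRange_quotEmb_toQuot.mono ?_
    rintro _ ⟨b, rfl⟩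
    refine Metric.mem_closure_iff.2 fun ε hε => ?_
    obtain ⟨c, hc⟩ := h b ε hε
    exact ⟨_, ⟨⟨φ.quotEmb (φ.toQuot c), φ.mem_gnsMul_domain a c⟩, rfl⟩, (key b c).symm ▸ hc⟩

/-- The von Neumann criterion for the operators of the GNS representation, expressed in the
`*`-algebra. -/
theorem isEssentiallySelfAdjoint_gnsMul_iff {a : R} (ha : star a = a) :
    IsEssentiallySelfAdjoint (φ.gnsMul a) ↔ ∀ z : ℂ, z * z = -1 → ∀ b : R, ∀ ε : ℝ, 0 < ε →
      ∃ c : R, φ.seminorm (b - (a * c + z • c)) < ε :=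
  ⟨fun h z hz => (φ.denseRange_gnsMul_add_smul_iff a z).1 (h.dense_range_add_smul hz),
    fun h => (φ.gnsMul_isFormalAdjoint ha).isEssentiallySelfAdjoint_of_dense
      (φ.dense_gnsMul_domain a) fun z hz => (φ.denseRange_gnsMul_add_smul_iff a z).2 (h z hz)⟩

theorem add_mem_closure (𝒜 : StarSubalgebra ℂ R) {f g : R} (hf : f ∈ φ.closure 𝒜)
    (hg : g ∈ φ.closure 𝒜) : f + g ∈ φ.closure 𝒜 := by
  intro ε hε
  obtain ⟨b, hb, hfb⟩ := hf _ (half_pos hε)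
  obtain ⟨c, hc, hgc⟩ := hg _ (half_pos hε)
  refine ⟨b + c, add_mem hb hc, ?_⟩
  rw [add_sub_add_comm]
  linarith [φ.seminorm_add_le (f - b) (g - c)]

theorem smul_mem_closure (𝒜 : StarSubalgebra ℂ R) (z : ℂ) {f : R} (hf : f ∈ φ.closure 𝒜) :
    z • f ∈ φ.closure 𝒜 := by
  intro ε hε
  have h1 : 0 < ‖z‖ + 1 := by positivity
  obtain ⟨b, hb, hfb⟩ := hf _ (div_pos hε h1)
  refine ⟨z • b, SMulMemClass.smul_mem z hb, ?_⟩
  rw [← smul_sub, seminorm_smul]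
  rw [lt_div_iff₀ h1] at hfb
  nlinarith [φ.seminorm_nonneg (f - b)]

theorem subset_closure (T : Set R) : T ⊆ φ.closure T := fun b hb ε hε =>
  ⟨b, hb, by rwa [sub_self, seminorm_zero]⟩

theorem mem_closure_of_forall_exists_mem_closure {T : Set R} {f : R}
    (h : ∀ ε : ℝ, 0 < ε → ∃ g ∈ φ.closure T, φ.seminorm (f - g) < ε) : f ∈ φ.closure T := by
  intro ε hε
  obtain ⟨g, hg, hfg⟩ := h _ (half_pos hε)
  obtain ⟨b, hb, hgb⟩ := hg _ (half_pos hε)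
  exact ⟨b, hb, φ.seminorm_sub_lt hfg hgb⟩

end Seminorm

section GraphClosure

theorem mul_sub_add_smul_sub {R : Type*} [Ring R] [Algebra ℂ R] (a : R) (z : ℂ)
    (g c : R) :
    a * (g - c) + z • (g - c) = a * g + z • g - (a * c + z • c) := by
  rw [mul_sub, smul_sub]
  abel

variable {R : Type*} [Ring R] [StarRing R] [Algebra ℂ R] [StarModule ℂ R] (φ : PosHermMap R)
  {𝒜 : StarSubalgebra ℂ R} {a : R}

/-- If `a ± i` is invertible in `R` and `𝒜` is dense for the graph seminorm of `a`, then
approximating `(a ± i)⁻¹ b` shows that `a ± i` has dense range on `𝒜`. -/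
theorem isEssentiallySelfAdjoint_of_graphClosure_eq_univ (ha : star a = a) (ha' : a ∈ 𝒜)
    (hinv : ∀ z : ℂ, z * z = -1 → ∀ b : R, ∃ g : R, a * g + z • g = b)
    (h : φ.graphClosure a 𝒜 = Set.univ) :
    IsEssentiallySelfAdjoint ((φ.restrict 𝒜).gnsMul ⟨a, ha'⟩) := by
  refine ((φ.restrict 𝒜).isEssentiallySelfAdjoint_gnsMul_iff (Subtype.ext ha)).2
    fun z hz b ε hε => ?_
  obtain ⟨g, hg⟩ := hinv z hz b
  obtain ⟨c, hc, hgc⟩ := (h ▸ Set.mem_univ g : g ∈ φ.graphClosure a 𝒜) ε hε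
  refine ⟨⟨c, hc⟩, ?_⟩
  rw [← φ.seminorm_mul_add_smul ha hz] at hgc
  rw [seminorm_restrict]
  change φ.seminorm ((b : R) - (a * c + z • c)) < ε
  rw [← hg]
  rwa [mul_sub_add_smul_sub] at hgc

/-- The range of `a ± i` on `𝒜` is dense in the closure of `𝒜` taken in all of `R`, not only in
`𝒜`. -/
theorem exists_seminorm_sub_lt (ha : star a = a) (ha' : a ∈ 𝒜)
    (h : IsEssentiallySelfAdjoint ((φ.restrict 𝒜).gnsMul ⟨a, ha'⟩)) {z : ℂ} (hz : z * z = -1)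
    {f : R} (hf : f ∈ φ.closure 𝒜) {ε : ℝ} (hε : 0 < ε) :
    ∃ c ∈ 𝒜, φ.seminorm (f - (a * c + z • c)) < ε := by
  obtain ⟨b, hb, hfb⟩ := hf _ (half_pos hε)
  obtain ⟨c, hc⟩ := ((φ.restrict 𝒜).isEssentiallySelfAdjoint_gnsMul_iff (Subtype.ext ha)).1 h z hz
    ⟨b, hb⟩ _ (half_pos hε)
  exact ⟨c, c.2, φ.seminorm_sub_lt hfb hc⟩

/-- The graph seminorm of `g - c` is the distance of `(a + i) g` from `(a + i) c`. -/
theorem graphClosure_eq_univ_of_isEssentiallySelfAdjoint (ha : star a = a) (ha' : a ∈ 𝒜)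
    (h : IsEssentiallySelfAdjoint ((φ.restrict 𝒜).gnsMul ⟨a, ha'⟩))
    (hc : φ.closure 𝒜 = Set.univ) : φ.graphClosure a 𝒜 = Set.univ := by
  refine Set.eq_univ_of_forall fun g ε hε => ?_
  obtain ⟨c, hc, hlt⟩ := φ.exists_seminorm_sub_lt ha ha' h Complex.I_mul_I
    (hc ▸ Set.mem_univ (a * g + Complex.I • g)) hε
  refine ⟨c, hc, ?_⟩
  rwa [← φ.seminorm_mul_add_smul ha Complex.I_mul_I, mul_sub_add_smul_sub]

/-- Essential self-adjointness makes the closure of `𝒜` invariant under the resolvents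
`(a ± i)⁻¹`. -/
theorem mem_closure_of_mul_add_smul_mem_closure (ha : star a = a) (ha' : a ∈ 𝒜)
    (h : IsEssentiallySelfAdjoint ((φ.restrict 𝒜).gnsMul ⟨a, ha'⟩)) {z : ℂ} (hz : z * z = -1)
    {g : R} (hg : a * g + z • g ∈ φ.closure 𝒜) : g ∈ φ.closure 𝒜 := by
  intro ε hε
  obtain ⟨c, hc, hlt⟩ := φ.exists_seminorm_sub_lt ha ha' h hz hg hε
  refine ⟨c, hc, lt_of_le_of_lt (φ.seminorm_le_graphSeminorm a _) ?_⟩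
  rwa [← φ.seminorm_mul_add_smul ha hz, mul_sub_add_smul_sub]

end GraphClosure

end PosHermMap

/-! ### Cutoff functions and tightness of `Φ` -/

theorem sigmaCompactSpace_of_lindelofSpace (X : Type*) [TopologicalSpace X]
    [WeaklyLocallyCompactSpace X] [LindelofSpace X] : SigmaCompactSpace X := by
  choose K hK hKx using fun x : X => exists_compact_mem_nhds x
  obtain ⟨t, ht, htU⟩ := countable_cover_nhds hKx
  exact SigmaCompactSpace.of_countable (K '' t) (ht.image K)
    (by rintro _ ⟨x, -, rfl⟩; exact hK x) (by rw [Set.sUnion_image, htU])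

section Cutoff

variable {X : Type*} [TopologicalSpace X] [T2Space X] [LocallyCompactSpace X] [LindelofSpace X]

/-- The functions `u k` vanish on the `k`-th member of a compact exhaustion and equal `1` outside
the interior of the next one, which makes the sequence decreasing. -/
theorem exists_antitone_cutoff : ∃ (u : ℕ → C(X, ℝ)) (K : ℕ → Set X), Antitone u ∧
    (∀ k x, u k x ∈ Set.Icc (0 : ℝ) 1) ∧ (∀ x, ∃ k, u k x = 0) ∧
    ∀ k, IsCompact (K k) ∧ ∀ x ∉ K k, u k x = 1 := by
  have := sigmaCompactSpace_of_lindelofSpace X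
  let K : CompactExhaustion X := default
  have hex (k : ℕ) := exists_continuous_zero_one_of_isCompact (K.isCompact k)
    (isOpen_interior (s := K (k + 1))).isClosed_compl
    (Set.disjoint_compl_right_iff_subset.2 (K.subset_interior_succ k))
  choose u hu0 hu1 hu using hex
  refine ⟨u, fun k => K (k + 1),
    antitone_nat_of_succ_le fun k => ContinuousMap.le_def.2 fun x => ?_, hu, fun x => ?_, fun k =>
    ⟨K.isCompact _, fun x hx => hu1 k fun h => hx (interior_subset h)⟩⟩
  · by_cases hx : x ∈ K (k + 1)
    · rw [show u (k + 1) x = 0 from hu0 (k + 1) hx]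
      exact (hu k x).1
    · rw [show u k x = 1 from hu1 k fun h => hx (interior_subset h)]
      exact (hu (k + 1) x).2
  · obtain ⟨k, hk⟩ := K.exists_mem x
    exact ⟨k, hu0 k hk⟩

theorem IsRieszIdeal.mem_of_abs_le {X : Type*} [TopologicalSpace X] {I : Subalgebra ℝ C(X, ℝ)}
    (hI : IsRieszIdeal (Subalgebra.toSubmodule I)) {r : C(X, ℝ)} (s : I)
    (h : ∀ x, |r x| ≤ |(s : C(X, ℝ)) x|) : r ∈ I :=
  hI r s s.2 fun x => by simpa using h x

variable {I : Subalgebra ℝ C(X, ℝ)} (hI : IsRieszIdeal (Subalgebra.toSubmodule I))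
  {Φ : I →ₚ[ℝ] ℝ} (hΦ : IsStrictlyContinuous Φ)

include hI hΦ in
/-- The tightness property which replaces the integral representation of `Φ`. -/
theorem IsStrictlyContinuous.exists_cutoff {f : I} (hf : 0 ≤ f) {ε : ℝ} (hε : 0 < ε) :
    ∃ (u : C(X, ℝ)) (v : I) (K : Set X), (∀ x, u x ∈ Set.Icc (0 : ℝ) 1) ∧ IsCompact K ∧
      (∀ x ∉ K, u x = 1) ∧ (v : C(X, ℝ)) = u * f ∧ Φ v < ε := by
  obtain ⟨u, K, hanti, hu, hu0, hK⟩ := exists_antitone_cutoff (X := X)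
  have hf' (x : X) : 0 ≤ (f : C(X, ℝ)) x := hf x
  have hmem (k : ℕ) : u k * f ∈ I := by
    refine hI.mem_of_abs_le f fun x => ?_
    rw [ContinuousMap.mul_apply, abs_mul]
    exact mul_le_of_le_one_left (abs_nonneg _) (abs_le.2 ⟨by linarith [(hu k x).1], (hu k x).2⟩)
  have hdec : DecreasesToZero fun k => ((⟨u k * f, hmem k⟩ : I) : C(X, ℝ)) := by
    refine ⟨fun k l hkl x => ?_, fun x => IsLeast.isGLB ⟨?_, ?_⟩⟩
    · exact mul_le_mul_of_nonneg_right (hanti hkl x) (hf' x)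
    · obtain ⟨k, hk⟩ := hu0 x
      exact ⟨k, by simp [hk]⟩
    · rintro _ ⟨k, rfl⟩
      exact mul_nonneg (hu k x).1 (hf' x)
  obtain ⟨_, ⟨k, rfl⟩, -, hk⟩ := (hΦ _ hdec).exists_between hε
  exact ⟨u k, _, K k, hu k, (hK k).1, (hK k).2, rfl, hk⟩

end Cutoff

/-! ### The embedding of `I` in its complexification -/

section Embedding

variable {X : Type*} [TopologicalSpace X] {I : Subalgebra ℝ C(X, ℝ)}

theorem embComplexify_mul (f g : I) : embComplexify (f * g) = embComplexify f * embComplexify g := by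
  apply ComplexAlg.val_injective
  rw [map_mul]
  ext x
  simp [val_embComplexify, toComplexFun]

theorem embComplexify_add (f g : I) : embComplexify (f + g) = embComplexify f + embComplexify g := by
  apply ComplexAlg.val_injective
  rw [map_add]
  ext x
  simp [val_embComplexify, toComplexFun]

theorem embComplexify_sub (f g : I) : embComplexify (f - g) = embComplexify f - embComplexify g := by
  apply ComplexAlg.val_injective
  rw [map_sub]
  ext x
  simp [val_embComplexify, toComplexFun]

theorem embComplexify_one : embComplexify (1 : I) = 1 := by
  apply ComplexAlg.val_injective
  rw [map_one]
  ext x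
  simp [val_embComplexify, toComplexFun]

theorem embComplexify_algebraMap (c : ℝ) :
    embComplexify (algebraMap ℝ I c) = algebraMap ℂ (ComplexAlg I) c := by
  apply ComplexAlg.val_injective
  rw [AlgHomClass.commutes]
  ext x
  simp [val_embComplexify, toComplexFun]

theorem star_embComplexify (f : I) : star (embComplexify f) = embComplexify f := by
  apply ComplexAlg.val_injective
  rw [map_star]
  ext x
  simp [val_embComplexify, toComplexFun]

theorem ComplexAlg.eq_emb_re_add_smul_emb_im (f : ComplexAlg I) :
    f = embComplexify f.re + Complex.I • embComplexify f.im :=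
  ComplexAlg.val_injective I <| by
    rw [map_add, map_smul]
    exact (eq_add_I_smul_iff _ _ _).2 ⟨rfl, rfl⟩

theorem seminorm_embComplexify_lt {Φ : I →ₚ[ℝ] ℝ} {f : I} {ε : ℝ} (hε : 0 < ε)
    (h : Φ (f * f) < ε ^ 2) : (complexifyMap Φ).seminorm (embComplexify f) < ε := by
  refine lt_of_pow_lt_pow_left₀ 2 hε.le ?_
  rwa [PosHermMap.seminorm_sq, star_embComplexify, ← embComplexify_mul, complexifyMap_emb,
    Complex.ofReal_re]

theorem map_le_map_of_forall_le (Φ : I →ₚ[ℝ] ℝ) {f g : I}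
    (h : ∀ x, (f : C(X, ℝ)) x ≤ (g : C(X, ℝ)) x) : Φ f ≤ Φ g :=
  OrderHomClass.mono Φ (show f ≤ g from h)

end Embedding

/-! ### Approximation by a point-separating algebra of bounded functions -/

section Density

variable {X : Type*} [TopologicalSpace X] [T2Space X] [LocallyCompactSpace X] [LindelofSpace X]
  {I : Subalgebra ℝ C(X, ℝ)} (hI : IsRieszIdeal (Subalgebra.toSubmodule I))
  {Φ : I →ₚ[ℝ] ℝ} (hΦ : IsStrictlyContinuous Φ)

include hI hΦ in
/-- The bounded approximant is `(1 - u) g` for a cutoff function `u`, since `(u g)² ≤ u g²`. -/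
theorem IsStrictlyContinuous.exists_bounded_seminorm_sub_lt (g : I) {ε : ℝ} (hε : 0 < ε) :
    ∃ h : I, (∃ M, ∀ x, |(h : C(X, ℝ)) x| ≤ M) ∧
      (complexifyMap Φ).seminorm (embComplexify (g - h)) < ε := by
  have hg2 : (0 : I) ≤ g * g := fun x => mul_self_nonneg _
  obtain ⟨u, v, K, hu, hK, huK, hv, hlt⟩ := hΦ.exists_cutoff hI hg2 (pow_pos hε 2)
  have hmem : u * g ∈ I := by
    refine hI.mem_of_abs_le g fun x => ?_
    rw [ContinuousMap.mul_apply, abs_mul]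
    exact mul_le_of_le_one_left (abs_nonneg _) (abs_le.2 ⟨by linarith [(hu x).1], (hu x).2⟩)
  refine ⟨g - ⟨u * g, hmem⟩, ?_, ?_⟩
  · obtain ⟨M, hM⟩ := hK.exists_bound_of_continuousOn (g : C(X, ℝ)).continuous.continuousOn
    refine ⟨max M 0, fun x => ?_⟩
    have h1 : ((g - ⟨u * g, hmem⟩ : I) : C(X, ℝ)) x = (1 - u x) * (g : C(X, ℝ)) x := by
      simp; ring
    rw [h1]
    by_cases hx : x ∈ K
    · refine le_max_of_le_left (le_trans ?_ (hM x hx))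
      rw [abs_mul]
      exact mul_le_of_le_one_left (abs_nonneg _)
        (abs_le.2 ⟨by linarith [(hu x).2], by linarith [(hu x).1]⟩)
    · simp [huK x hx]
  · rw [sub_sub_cancel]
    refine seminorm_embComplexify_lt hε (lt_of_le_of_lt (map_le_map_of_forall_le Φ fun x => ?_) hlt)
    have h2 : (v : C(X, ℝ)) x = u x * ((g : C(X, ℝ)) x * (g : C(X, ℝ)) x) := by rw [hv]; rfl
    rw [h2]
    change u x * (g : C(X, ℝ)) x * (u x * (g : C(X, ℝ)) x) ≤ _
    have h3 := mul_le_of_le_one_left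
      (mul_nonneg (hu x).1 (mul_self_nonneg ((g : C(X, ℝ)) x))) (hu x).2
    linarith

theorem abs_clamp_sub_le {M g : ℝ} (hg : |g| ≤ M) (b : ℝ) :
    |max (-M) (min M b) - g| ≤ |b - g| := by
  obtain ⟨h1, h2⟩ := abs_le.1 hg
  rcases max_cases (-M) (min M b) with h | h <;> rcases min_cases M b with h' | h' <;>
    rcases abs_cases (b - g) with h'' | h'' <;> rw [abs_le] <;> constructor <;> linarith

include hI hΦ in
/-- A weak form of the Stone–Weierstrass theorem on a non-compact space: `g` is approximated by `b`
on a compact set with small complement, and a polynomial in `b` which is close to the truncation of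
`b` to `[-M, M]` keeps the error bounded outside that set. -/
theorem IsStrictlyContinuous.exists_mem_seminorm_sub_lt {D : Subalgebra ℝ I}
    (hD : IsPointSeparating (D : Set I)) (hb : ∀ b ∈ D, ∃ M, ∀ x, |(b : C(X, ℝ)) x| ≤ M)
    {g : I} {M : ℝ} (hM : 0 ≤ M) (hg : ∀ x, |(g : C(X, ℝ)) x| ≤ M) {ε : ℝ} (hε : 0 < ε) :
    ∃ d ∈ D, (complexifyMap Φ).seminorm (embComplexify (g - d)) < ε := by
  have h1 : (0 : I) ≤ 1 := fun x => zero_le_one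
  have hΦ1 : 0 ≤ Φ 1 := map_nonneg Φ h1
  obtain ⟨δ, hδ0, hδ1, hδ⟩ : ∃ δ : ℝ, 0 < δ ∧ δ ≤ 1 ∧ 4 * δ ^ 2 * Φ 1 ≤ ε ^ 2 / 2 := by
    have hpos : 0 < ε ^ 2 / (8 * (Φ 1 + 1)) := by positivity
    refine ⟨min 1 (ε ^ 2 / (8 * (Φ 1 + 1))), lt_min one_pos hpos, min_le_left _ _, ?_⟩
    set δ := min 1 (ε ^ 2 / (8 * (Φ 1 + 1))) with hδ
    have h2 : δ * (8 * (Φ 1 + 1)) ≤ ε ^ 2 := by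
      rw [← le_div_iff₀ (by positivity)]
      exact min_le_right _ _
    have h3 : 0 < δ := lt_min one_pos hpos
    have h4 : δ ^ 2 ≤ δ := by nlinarith [min_le_left 1 (ε ^ 2 / (8 * (Φ 1 + 1)))]
    nlinarith
  have hM' : 0 < (2 * M + 1) ^ 2 := by positivity
  obtain ⟨u, v, K, hu, hK, huK, hv, hlt⟩ :=
    hΦ.exists_cutoff hI h1 (ε := ε ^ 2 / 2 / (2 * M + 1) ^ 2) (by positivity)
  rw [lt_div_iff₀ hM'] at hlt
  have hv' (x : X) : (v : C(X, ℝ)) x = u x := by rw [hv]; simp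
  have hsep : (D.map I.val).SeparatesPoints := fun x y hxy => by
    obtain ⟨s, hs, hne⟩ := hD x y hxy
    exact ⟨s, ⟨s, ⟨s, hs, rfl⟩, rfl⟩, hne⟩
  obtain ⟨_, ⟨b, hbD, rfl⟩, hbg⟩ :=
    ContinuousMap.exists_mem_subalgebra_near_continuous_of_isCompact_of_separatesPoints hsep
      (g : C(X, ℝ)) hK hδ0
  obtain ⟨B, hB⟩ := hb b hbD
  obtain ⟨p, hp⟩ := exists_polynomial_near_of_continuousOn (-B) B
    (fun t => max (-M) (min M t)) (by fun_prop) δ hδ0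
  refine ⟨Polynomial.aeval b p, ?_, seminorm_embComplexify_lt hε ?_⟩
  · have h5 := Polynomial.aeval_algHom_apply D.val (⟨b, hbD⟩ : D) p
    rw [show Polynomial.aeval b p = _ from h5]
    exact Subtype.property _
  have hev (x : X) : ((Polynomial.aeval b p : I) : C(X, ℝ)) x =
      p.eval ((b : C(X, ℝ)) x) := by
    have h5 := Polynomial.aeval_algHom_apply ((ContinuousMap.evalAlgHom ℝ ℝ x).comp I.val) b p
    rw [Polynomial.coe_aeval_eq_eval] at h5
    exact h5.symm
  -- The error is at most `2 δ` on `K`, and at most `2 M + δ ≤ 2 M + 1` outside `K`, where `u = 1`.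
  have hpt (x : X) : ((g : C(X, ℝ)) x - p.eval ((b : C(X, ℝ)) x)) ^ 2 ≤
      4 * δ ^ 2 + (2 * M + 1) ^ 2 * u x := by
    have h6 := hp ((b : C(X, ℝ)) x) (abs_le.1 (hB x))
    by_cases hx : x ∈ K
    · have h7 : |(b : C(X, ℝ)) x - (g : C(X, ℝ)) x| < δ := hbg x hx
      have h8 := (abs_clamp_sub_le (hg x) ((b : C(X, ℝ)) x)).trans_lt h7
      have h9 : |(g : C(X, ℝ)) x - p.eval ((b : C(X, ℝ)) x)| ≤ 2 * δ := by
        rw [abs_lt] at h6 h8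
        rw [abs_le]
        constructor <;> linarith
      have h10 := sq_le_sq' (abs_le.1 h9).1 (abs_le.1 h9).2
      nlinarith [(hu x).1]
    · have h8 : |max (-M) (min M ((b : C(X, ℝ)) x))| ≤ M :=
        abs_le.2 ⟨le_max_left _ _, max_le (by linarith) (min_le_left _ _)⟩
      have h9 : |(g : C(X, ℝ)) x - p.eval ((b : C(X, ℝ)) x)| ≤ 2 * M + 1 := by
        have h7 := hg x
        rw [abs_lt] at h6
        rw [abs_le] at h7 h8 ⊢
        constructor <;> linarith
      have h10 := sq_le_sq' (abs_le.1 h9).1 (abs_le.1 h9).2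
      rw [huK x hx]
      nlinarith
  have hle : Φ ((g - Polynomial.aeval b p) * (g - Polynomial.aeval b p)) ≤
      Φ ((4 * δ ^ 2) • 1 + (2 * M + 1) ^ 2 • v) := by
    refine map_le_map_of_forall_le Φ fun x => ?_
    have h5 := hpt x
    rw [← hev, ← hv'] at h5
    simpa [sq] using h5
  rw [map_add, map_smul, map_smul, smul_eq_mul, smul_eq_mul] at hle
  linarith

end Density

/-! ### Resolvents and bounded multipliers of the closure -/

section Multipliers

variable {X : Type*} [TopologicalSpace X] {I : Subalgebra ℝ C(X, ℝ)}

/-- The algebra of all bounded functions in `I` for which multiplication leaves the closure of `𝒜`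
with respect to `‖·‖_φ` invariant. -/
def boundedMultipliers (φ : PosHermMap (ComplexAlg I)) (𝒜 : StarSubalgebra ℂ (ComplexAlg I)) :
    Subalgebra ℝ I where
  carrier := {f | (∃ M, ∀ x, |(f : C(X, ℝ)) x| ≤ M) ∧
    ∀ g ∈ φ.closure 𝒜, embComplexify f * g ∈ φ.closure 𝒜}
  mul_mem' := by
    rintro f f' ⟨⟨M, hM⟩, hf⟩ ⟨⟨M', hM'⟩, hf'⟩
    refine ⟨⟨M * M', fun x => ?_⟩, fun g hg => ?_⟩
    · change |(f : C(X, ℝ)) x * (f' : C(X, ℝ)) x| ≤ _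
      rw [abs_mul]
      exact mul_le_mul (hM x) (hM' x) (abs_nonneg _) ((abs_nonneg _).trans (hM x))
    · rw [embComplexify_mul, mul_assoc]
      exact hf _ (hf' g hg)
  add_mem' := by
    rintro f f' ⟨⟨M, hM⟩, hf⟩ ⟨⟨M', hM'⟩, hf'⟩
    refine ⟨⟨M + M', fun x => (abs_add_le _ _).trans (add_le_add (hM x) (hM' x))⟩, fun g hg => ?_⟩
    rw [embComplexify_add, add_mul]
    exact φ.add_mem_closure 𝒜 (hf g hg) (hf' g hg)
  algebraMap_mem' c := by
    refine ⟨⟨|c|, fun x => le_rfl⟩, fun g hg => ?_⟩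
    rw [embComplexify_algebraMap, ← Algebra.smul_def]
    exact φ.smul_mem_closure 𝒜 _ hg

theorem IsRieszIdeal.exists_inv_sq_add_one (hI : IsRieszIdeal (Subalgebra.toSubmodule I)) (a : I) :
    ∃ r : I, r * (a * a + 1) = 1 := by
  have hpos (x : X) : 0 < (a : C(X, ℝ)) x * (a : C(X, ℝ)) x + 1 :=
    add_pos_of_nonneg_of_pos (mul_self_nonneg _) one_pos
  let r : C(X, ℝ) := ⟨fun x => ((a : C(X, ℝ)) x * (a : C(X, ℝ)) x + 1)⁻¹,
    Continuous.inv₀ (by fun_prop) fun x => (hpos x).ne'⟩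
  refine ⟨⟨r, hI.mem_of_abs_le 1 fun x => ?_⟩, Subtype.ext (ContinuousMap.ext fun x => ?_)⟩
  · change |((a : C(X, ℝ)) x * (a : C(X, ℝ)) x + 1)⁻¹| ≤ |1|
    rw [abs_of_pos (inv_pos.2 (hpos x)), abs_one]
    exact inv_le_one_of_one_le₀ (by linarith [mul_self_nonneg ((a : C(X, ℝ)) x)])
  · exact inv_mul_cancel₀ (hpos x).ne'

/-- The inverse of `a + z`, for `z = ± i`, is `(a - z) r` with `r = (a² + 1)⁻¹`. -/
theorem embComplexify_mul_resolvent {a r : I} (hr : r * (a * a + 1) = 1) {z : ℂ} (hz : z * z = -1)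
    (b : ComplexAlg I) :
    embComplexify a * (embComplexify (a * r) * b - z • (embComplexify r * b)) +
      z • (embComplexify (a * r) * b - z • (embComplexify r * b)) = b := by
  have h1 := congrArg embComplexify hr
  rw [embComplexify_mul, embComplexify_add, embComplexify_mul, embComplexify_one] at h1
  have h2 := congrArg (algebraMap ℂ (ComplexAlg I)) hz
  rw [map_mul, map_neg, map_one] at h2
  rw [embComplexify_mul]
  simp only [Algebra.smul_def]
  linear_combination b * h1 - embComplexify r * b * h2

/-- The closure of `𝒜` is invariant under multiplication by the bounded functions `(a² + 1)⁻¹` and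
`a (a² + 1)⁻¹`, which are combinations of resolvents. -/
theorem mul_mem_closure_of_isEssentiallySelfAdjoint {φ : PosHermMap (ComplexAlg I)}
    {𝒜 : StarSubalgebra ℂ (ComplexAlg I)} {a r : I} (ha : embComplexify a ∈ 𝒜)
    (h : IsEssentiallySelfAdjoint ((φ.restrict 𝒜).gnsMul ⟨embComplexify a, ha⟩))
    (hr : r * (a * a + 1) = 1) {g : ComplexAlg I} (hg : g ∈ φ.closure 𝒜) :
    embComplexify r * g ∈ φ.closure 𝒜 ∧ embComplexify (a * r) * g ∈ φ.closure 𝒜 := by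
  have key (z : ℂ) (hz : z * z = -1) :
      embComplexify (a * r) * g - z • (embComplexify r * g) ∈ φ.closure 𝒜 :=
    φ.mem_closure_of_mul_add_smul_mem_closure (star_embComplexify a) ha h hz <| by
      rwa [embComplexify_mul_resolvent hr hz]
  have h1 := key Complex.I Complex.I_mul_I
  have h2 := key (-Complex.I) (by simp)
  -- With `h1`, `h2` for `(a ± i)⁻¹ g`: `r = (i / 2) ((a + i)⁻¹ - (a - i)⁻¹)` and
  -- `a r = ((a + i)⁻¹ + (a - i)⁻¹) / 2`.
  constructor
  · convert φ.add_mem_closure 𝒜 (φ.smul_mem_closure 𝒜 (Complex.I / 2) h1)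
      (φ.smul_mem_closure 𝒜 (-Complex.I / 2) h2) using 1
    have h3 : Complex.I / 2 * Complex.I = -1 / 2 := by
      linear_combination (1 / 2 : ℂ) * Complex.I_mul_I
    have h4 : -Complex.I / 2 * -Complex.I = -1 / 2 := by
      linear_combination (1 / 2 : ℂ) * Complex.I_mul_I
    rw [smul_sub, smul_sub, smul_smul, smul_smul, h3, h4]
    module
  · convert φ.smul_mem_closure 𝒜 (1 / 2) (φ.add_mem_closure 𝒜 h1 h2) using 1
    module

/-- The functions `(a² + 1)⁻¹` and `a (a² + 1)⁻¹` with `a ∈ S` together separate the points which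
`S` separates, and they are bounded. -/
theorem boundedMultipliers_isPointSeparating (hI : IsRieszIdeal (Subalgebra.toSubmodule I))
    {φ : PosHermMap (ComplexAlg I)} {𝒜 : StarSubalgebra ℂ (ComplexAlg I)} {S : Set I}
    (hS : IsPointSeparating S) (hS𝒜 : ∀ a ∈ S, embComplexify a ∈ 𝒜)
    (h : ∀ (a : I) (ha : a ∈ S),
      IsEssentiallySelfAdjoint ((φ.restrict 𝒜).gnsMul ⟨embComplexify a, hS𝒜 a ha⟩)) :
    IsPointSeparating (boundedMultipliers φ 𝒜 : Set I) := by
  intro x y hxy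
  obtain ⟨a, ha, hne⟩ := hS x y hxy
  obtain ⟨r, hr⟩ := hI.exists_inv_sq_add_one a
  have hrx (t : X) : (r : C(X, ℝ)) t * ((a : C(X, ℝ)) t * (a : C(X, ℝ)) t + 1) = 1 :=
    congrArg (fun f : I => (f : C(X, ℝ)) t) hr
  have hr0 (t : X) : 0 < (r : C(X, ℝ)) t := by
    refine pos_of_mul_pos_left (b := (a : C(X, ℝ)) t * (a : C(X, ℝ)) t + 1) ?_
      (add_nonneg (mul_self_nonneg _) zero_le_one)
    rw [hrx t]
    exact one_pos
  have hrm : r ∈ boundedMultipliers φ 𝒜 := by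
    refine ⟨⟨1, fun t => ?_⟩, fun g hg =>
      (mul_mem_closure_of_isEssentiallySelfAdjoint _ (h a ha) hr hg).1⟩
    -- `r ≤ r (a² + 1) = 1`
    rw [abs_of_pos (hr0 t)]
    nlinarith [hrx t, hr0 t, mul_nonneg (hr0 t).le (mul_self_nonneg ((a : C(X, ℝ)) t))]
  have harm : a * r ∈ boundedMultipliers φ 𝒜 := by
    refine ⟨⟨1, fun t => ?_⟩, fun g hg =>
      (mul_mem_closure_of_isEssentiallySelfAdjoint _ (h a ha) hr hg).2⟩
    change |(a : C(X, ℝ)) t * (r : C(X, ℝ)) t| ≤ 1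
    -- `2 |a| r ≤ (a² + 1) r = 1`
    have h1 := mul_nonneg (hr0 t).le (sq_nonneg ((a : C(X, ℝ)) t - 1))
    have h2 := mul_nonneg (hr0 t).le (sq_nonneg ((a : C(X, ℝ)) t + 1))
    rw [abs_le]
    constructor <;> nlinarith [hrx t, hr0 t]
  by_cases hxy' : (r : C(X, ℝ)) x = (r : C(X, ℝ)) y
  · refine ⟨a * r, harm, fun h' => hne ?_⟩
    change (a : C(X, ℝ)) x * (r : C(X, ℝ)) x = (a : C(X, ℝ)) y * (r : C(X, ℝ)) y at h'
    rw [← hxy'] at h'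
    exact mul_right_cancel₀ (hr0 x).ne' h'
  · exact ⟨r, hrm, hxy'⟩

/-- Every multiplier `d` lies in the closure of `𝒜`, since `d = d * 1`; so it suffices to approximate
by multipliers, which is possible for bounded and then for all functions in `I`. -/
theorem IsStrictlyContinuous.closure_eq_univ [T2Space X] [LocallyCompactSpace X] [LindelofSpace X]
    [Nonempty X] (hI : IsRieszIdeal (Subalgebra.toSubmodule I)) {Φ : I →ₚ[ℝ] ℝ}
    (hΦ : IsStrictlyContinuous Φ) {𝒜 : StarSubalgebra ℂ (ComplexAlg I)}
    (hD : IsPointSeparating (boundedMultipliers (complexifyMap Φ) 𝒜 : Set I)) :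
    (complexifyMap Φ).closure 𝒜 = Set.univ := by
  have hsub (d : I) (hd : d ∈ boundedMultipliers (complexifyMap Φ) 𝒜) :
      embComplexify d ∈ (complexifyMap Φ).closure 𝒜 := by
    have := hd.2 1 ((complexifyMap Φ).subset_closure _ (one_mem 𝒜))
    rwa [mul_one] at this
  have hreal (f : I) : embComplexify f ∈ (complexifyMap Φ).closure 𝒜 := by
    refine (complexifyMap Φ).mem_closure_of_forall_exists_mem_closure fun ε hε => ?_
    obtain ⟨g, ⟨M, hM⟩, hfg⟩ := hΦ.exists_bounded_seminorm_sub_lt hI f (half_pos hε)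
    have hM0 : 0 ≤ M := (abs_nonneg _).trans (hM (Classical.arbitrary X))
    obtain ⟨d, hd, hgd⟩ := hΦ.exists_mem_seminorm_sub_lt hI hD (fun b hb => hb.1) hM0 hM
      (half_pos hε)
    rw [embComplexify_sub] at hfg hgd
    exact ⟨_, hsub d hd, (complexifyMap Φ).seminorm_sub_lt hfg hgd⟩
  refine Set.eq_univ_of_forall fun f => ?_
  rw [f.eq_emb_re_add_smul_emb_im]
  exact (complexifyMap Φ).add_mem_closure 𝒜 (hreal _)
    ((complexifyMap Φ).smul_mem_closure 𝒜 _ (hreal _))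

end Multipliers

theorem mainTheorem3 {X : Type*} [TopologicalSpace X] [T2Space X] [LocallyCompactSpace X]
    [LindelofSpace X] [Nonempty X]
    (I : Subalgebra ℝ C(X, ℝ)) (hI : IsRieszIdeal (Subalgebra.toSubmodule I))
    (Φ : I →ₚ[ℝ] ℝ) (hΦ : IsStrictlyContinuous Φ)
    (A : Subalgebra ℝ I) (S : Set I) (hSA : S ⊆ A) (hS : IsPointSeparating S) :
    ((∀ a ∈ S, (complexifyMap Φ).graphClosure (embComplexify a) (complexifySub A) = Set.univ) ↔
      (∀ (a : I) (ha : a ∈ S), IsEssentiallySelfAdjoint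
        (((complexifyMap Φ).restrict (complexifySub A)).gnsMul
          ⟨embComplexify a, embComplexify_mem (hSA ha)⟩))) ∧
    ((∀ a ∈ S, (complexifyMap Φ).graphClosure (embComplexify a) (complexifySub A) = Set.univ) →
      (complexifyMap Φ).closure (complexifySub A) = Set.univ) := by
  have hfwd (h : ∀ a ∈ S, (complexifyMap Φ).graphClosure (embComplexify a) (complexifySub A) =
      Set.univ) (a : I) (ha : a ∈ S) : IsEssentiallySelfAdjoint
      (((complexifyMap Φ).restrict (complexifySub A)).gnsMul
        ⟨embComplexify a, embComplexify_mem (hSA ha)⟩) := by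
    obtain ⟨r, hr⟩ := hI.exists_inv_sq_add_one a
    exact (complexifyMap Φ).isEssentiallySelfAdjoint_of_graphClosure_eq_univ (star_embComplexify a)
      (embComplexify_mem (hSA ha))
      (fun z hz b => ⟨_, embComplexify_mul_resolvent hr hz b⟩) (h a ha)
  have hdense (h : ∀ (a : I) (ha : a ∈ S), IsEssentiallySelfAdjoint
      (((complexifyMap Φ).restrict (complexifySub A)).gnsMul
        ⟨embComplexify a, embComplexify_mem (hSA ha)⟩)) :=
    hΦ.closure_eq_univ hI (boundedMultipliers_isPointSeparating hI hS
      (fun a ha => embComplexify_mem (hSA ha)) h)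
  exact ⟨⟨hfwd, fun h a ha =>
    (complexifyMap Φ).graphClosure_eq_univ_of_isEssentiallySelfAdjoint (star_embComplexify a)
      (embComplexify_mem (hSA ha)) (h a ha) (hdense h)⟩, fun h => hdense (hfwd h)⟩
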